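/- Let $q$ be an indeterminate. For $0\le k\le n$ let $\begin{bmatrix} n\\ k\end{bmatrix}_q=\dfrac{(q;q)_n}{(q;q)_k\,(q;q)_{n-k}}$, where $(a;q)_m=\prod_{i=0}^{m-1}(1-aq^i)$; let $[m]_q=(1-q^m)/(1-q)$, and let $$C_k(q)=\frac{1}{[k+1]_q}\begin{bmatrix} 2k\\ k\end{bmatrix}_q$$ be the $q$-Catalan numbers, which are polynomials in $q$ with integer coefficients. Let $\Phi_n(q)$ be the $n$th cyclotomic polynomial. Theorem. For every positive integer $n$, the following congruences hold modulo $\Phi_n(q)^2$ in $\mathbb{Z}[q]$: $$\sum_{k=0}^{n-1}q^kC_k(q)\equiv \begin{cases} -q^{\frac{n^2-1}{3}}-q^{\frac{n(2n-1)}{3}} & \text{if } n\equiv 2\pmod 3,\\[4pt] q^{\frac{n^2-1}{3}}-\frac{n-1}{3}\,(q^n-1) & \text{if } n\equiv 1\pmod 3. \end{cases}$$ -/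

import Mathlib

open Polynomial

noncomputable section

namespace QCatalan

/-- The indeterminate `q`, as an element of the field of fractions of `ℤ[q]`, which is the
field `ℚ(q)` of rational functions. -/
def q : RatFunc ℤ := RatFunc.X

/-- The `q`-shifted factorial `(a;q)_n = (1 - a)(1 - a q) ⋯ (1 - a q^(n-1))`. -/
def qShifted (a : RatFunc ℤ) (n : ℕ) : RatFunc ℤ := ∏ i ∈ Finset.range n, (1 - a * q ^ i)

/-- The `q`-integer `[n]_q = (1 - q^n) / (1 - q)`. -/
def qInt (n : ℕ) : RatFunc ℤ := (1 - q ^ n) / (1 - q)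

/-- The `q`-binomial coefficient, equal to `(q;q)_n / ((q;q)_k (q;q)_(n-k))` for `0 ≤ k ≤ n`
and to `0` otherwise. The denominators are nonzero since `q` is an indeterminate. -/
def qBinom (n k : ℕ) : RatFunc ℤ :=
  if k ≤ n then qShifted q n / (qShifted q k * qShifted q (n - k)) else 0

/-- The `q`-Catalan number `C_n(q)`, the central `q`-binomial coefficient over `[n+1]_q`. -/
def qCatalan (n : ℕ) : RatFunc ℤ := qBinom (2 * n) n / qInt (n + 1)

/-- `A ≡ B (mod P)`: the difference `A - B` is a polynomial with integer coefficients which is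
divisible by `P` in `ℤ[q]`. -/
def QCongr (A B : RatFunc ℤ) (P : ℤ[X]) : Prop :=
  ∃ g : ℤ[X], A - B = algebraMap ℤ[X] (RatFunc ℤ) (P * g)

end QCatalan

end

/-
Divisibility by the square of `Φ_n(q)` is the vanishing of the value and of the derivative at a
primitive `n`-th root of unity `z`, so everything is evaluated at the dual number `z (1 + ε)`.
Writing `C_k(q) = [2k, k] - q [2k, k + 1]`, the sum becomes `A_0 - q A_1` with
`A_s = ∑_{k < n} q ^ k [2k, k + s]`, and telescoping in `n` rewrites `A_s` in terms of the
`[2n, n + j]` with `j` in two residue classes modulo 3. The term `[2n, 2n] = 1` contributes the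
powers of `q` in the theorem. For `0 < j < n` the value of `[2n, n + j]` at `z (1 + ε)` is `ε` times
`2n` times a power of a square root `η` of `z` over `1 - z ^ j`. As `n` is prime to 3, the resulting
Appell-Lerch type sums can be rewritten, for `h = η ^ 3`, as multiples of
`∑ (-1) ^ l h ^ (l (l + 1 - 2N)) / (1 - h ^ (2l))`. A recursion in `N` reduces this to a sum of
terms `1 / (1 - h ^ (2l))` over an interval which is symmetric modulo `n`, and the terms for `l` and
`n - l` add up to 1.
-/

namespace QCatalan

section GaussBinom

variable {R : Type*} [CommRing R]

/-- The Gaussian binomial coefficient at an element `x` of a commutative ring. It is defined by the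
`q`-Pascal recursion so that it can be evaluated at roots of unity, where the quotient of
`q`-shifted factorials is `0 / 0`. -/
def gaussBinom (x : R) : ℕ → ℕ → R
  | _, 0 => 1
  | 0, _ + 1 => 0
  | n + 1, k + 1 => gaussBinom x n k + x ^ (k + 1) * gaussBinom x n (k + 1)

variable (x : R)

@[simp]
lemma gaussBinom_zero_right (n : ℕ) : gaussBinom x n 0 = 1 := by
  cases n <;> rfl

@[simp]
lemma gaussBinom_zero_succ (k : ℕ) : gaussBinom x 0 (k + 1) = 0 := rfl

lemma gaussBinom_succ_succ (n k : ℕ) :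
    gaussBinom x (n + 1) (k + 1) = gaussBinom x n k + x ^ (k + 1) * gaussBinom x n (k + 1) := rfl

lemma gaussBinom_eq_zero_of_lt {n k : ℕ} (h : n < k) : gaussBinom x n k = 0 := by
  induction n generalizing k with
  | zero => obtain ⟨k, rfl⟩ := Nat.exists_eq_add_one.2 h; rfl
  | succ n ih =>
    obtain ⟨k, rfl⟩ := Nat.exists_eq_add_one.2 (n.succ_pos.trans h)
    rw [gaussBinom_succ_succ, ih (by lia), ih (by lia), mul_zero, add_zero]

@[simp]
lemma gaussBinom_self (n : ℕ) : gaussBinom x n n = 1 := by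
  induction n with
  | zero => rfl
  | succ n ih =>
    rw [gaussBinom_succ_succ, ih, gaussBinom_eq_zero_of_lt x n.lt_succ_self, mul_zero, add_zero]

lemma map_gaussBinom {S F : Type*} [CommRing S] [FunLike F R S] [RingHomClass F R S] (f : F)
    (n k : ℕ) : f (gaussBinom x n k) = gaussBinom (f x) n k := by
  induction n generalizing k with
  | zero => cases k <;> simp
  | succ n ih => cases k <;> simp [gaussBinom_succ_succ, ih]

/- Here and below the truncated subtraction `n - k` is harmless: the Gaussian binomials it
multiplies vanish for `n < k`. -/
lemma pow_mul_pow_sub_mul_gaussBinom {n k l : ℕ} (h : k ≤ l) :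
    x ^ k * x ^ (n - k) * gaussBinom x n l = x ^ n * gaussBinom x n l := by
  rcases le_or_gt k n with hk | hk
  · rw [pow_mul_pow_sub x hk]
  · rw [gaussBinom_eq_zero_of_lt x (hk.trans_le h), mul_zero, mul_zero]

lemma one_sub_pow_sub_mul_gaussBinom (n k : ℕ) :
    (1 - x ^ (n - k)) * gaussBinom x n k = (1 - x ^ (k + 1)) * gaussBinom x n (k + 1) := by
  induction n generalizing k with
  | zero => simp
  | succ n ih =>
    cases k with
    | zero =>
      have h := ih 0
      simp only [gaussBinom_succ_succ, gaussBinom_zero_right, tsub_zero] at h ⊢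
      linear_combination x * h
    | succ k =>
      have h₀ := pow_mul_pow_sub_mul_gaussBinom x (n := n) k.le_succ
      have h₁ := pow_mul_pow_sub_mul_gaussBinom x (n := n) (le_refl (k + 1))
      rw [gaussBinom_succ_succ, gaussBinom_succ_succ, Nat.add_sub_add_right]
      linear_combination ih k + x ^ (k + 2) * ih (k + 1) - x * h₀ + x * h₁

lemma gaussBinom_succ_succ' (n k : ℕ) :
    gaussBinom x (n + 1) (k + 1) = x ^ (n - k) * gaussBinom x n k + gaussBinom x n (k + 1) := by
  rw [gaussBinom_succ_succ]
  linear_combination one_sub_pow_sub_mul_gaussBinom x n k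

lemma one_sub_pow_mul_gaussBinom_succ_succ (n k : ℕ) :
    (1 - x ^ (k + 1)) * gaussBinom x (n + 1) (k + 1) = (1 - x ^ (n + 1)) * gaussBinom x n k := by
  rw [gaussBinom_succ_succ]
  linear_combination -x ^ (k + 1) * one_sub_pow_sub_mul_gaussBinom x n k
    - x * pow_mul_pow_sub_mul_gaussBinom x (n := n) (le_refl k)

/-- The Gaussian Catalan number at an element `x` of a commutative ring, written without
division. -/
def gaussCatalan (k : ℕ) : R := gaussBinom x (2 * k) k - x * gaussBinom x (2 * k) (k + 1)

lemma map_gaussCatalan {S F : Type*} [CommRing S] [FunLike F R S] [RingHomClass F R S] (f : F)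
    (k : ℕ) : f (gaussCatalan x k) = gaussCatalan (f x) k := by
  simp only [gaussCatalan, map_sub, map_mul, map_gaussBinom]

end GaussBinom

section CentralSum

variable {R : Type*} [CommRing R] (x : R)

lemma gaussBinom_central_succ (n j : ℕ) :
    gaussBinom x (2 * (n + 1)) (n + j + 2) =
      x ^ (n - j) * gaussBinom x (2 * n) (n + j) +
      (1 + x ^ (2 * n + 1)) * gaussBinom x (2 * n) (n + j + 1) +
      x ^ (n + j + 2) * gaussBinom x (2 * n) (n + j + 2) := by
  have h₁ : gaussBinom x (2 * n + 1) (n + j + 1) = _ := gaussBinom_succ_succ' x _ _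
  have h₂ : gaussBinom x (2 * n + 1) (n + j + 2) = _ := gaussBinom_succ_succ' x _ _
  have h₃ := pow_mul_pow_sub_mul_gaussBinom x (n := 2 * n) (le_refl (n + j + 1))
  rw [show 2 * n - (n + j) = n - j by lia] at h₁
  rw [show 2 * (n + 1) = 2 * n + 1 + 1 by ring, gaussBinom_succ_succ]
  linear_combination h₁ + x ^ (n + j + 2) * h₂ + x * h₃

/-- The combination of two neighbouring Gaussian binomials whose increment in `n` involves only
Gaussian binomials at distance three from each other. -/
def centralPair (n j : ℕ) : R :=
  gaussBinom x (2 * n) (n + j + 1) - x ^ (2 * j + 3) * gaussBinom x (2 * n) (n + j + 2)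

lemma pow_mul_centralPair_succ (n j : ℕ) :
    x ^ j * centralPair x (n + 1) j = x ^ j * centralPair x n j +
      (x ^ n * gaussBinom x (2 * n) (n + j) -
        x ^ (n + 4 * j + 6) * gaussBinom x (2 * n) (n + j + 3)) := by
  have hpow (i : ℕ) : x ^ i * x ^ (n - i) * gaussBinom x (2 * n) (n + i) =
      x ^ n * gaussBinom x (2 * n) (n + i) := by
    rcases le_or_gt i n with hi | hi
    · rw [pow_mul_pow_sub x hi]
    · rw [gaussBinom_eq_zero_of_lt x (by lia), mul_zero, mul_zero]
  have h₁ := gaussBinom_central_succ x n j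
  have h₂ := gaussBinom_central_succ x n (j + 1)
  have h₃ := one_sub_pow_sub_mul_gaussBinom x (2 * n) (n + j + 1)
  have h₄ := hpow (j + 1)
  rw [show 2 * n - (n + j + 1) = n - (j + 1) by lia] at h₃
  simp only [← add_assoc, show n + j + 1 + 2 = n + j + 3 by ring,
    show n + j + 1 + 1 = n + j + 2 by ring] at h₂ h₃ h₄
  simp only [centralPair, show n + 1 + j + 1 = n + j + 2 by ring,
    show n + 1 + j + 2 = n + j + 3 by ring]
  linear_combination x ^ j * h₁ - x ^ (3 * j + 3) * h₂ + hpow j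
    - (x ^ (2 * j + 2) + x ^ (n + j + 1)) * h₄ - x ^ (n + 2 * j + 2) * h₃

/-- The sum `∑ q ^ k [2k, k + s]` over `0 ≤ k < n` of shifted central Gaussian binomials. -/
def centralSum (s n : ℕ) : R := ∑ k ∈ Finset.range n, x ^ k * gaussBinom x (2 * k) (k + s)

theorem centralSum_eq_sum_centralPair (s M n : ℕ) (hn : n ≤ 3 * M + s) :
    centralSum x s n = ∑ m ∈ Finset.range M,
      x ^ (6 * m ^ 2 + 4 * s * m + (3 * m + s)) * centralPair x n (3 * m + s) := by
  induction n with
  | zero => simp [centralSum, centralPair, gaussBinom_eq_zero_of_lt]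
  | succ n ih =>
    let u (m : ℕ) : R := x ^ (6 * m ^ 2 + 4 * s * m + n) * gaussBinom x (2 * n) (n + (3 * m + s))
    have hu₀ : u 0 = x ^ n * gaussBinom x (2 * n) (n + s) := by simp [u]
    have huM : u M = 0 := by
      simp only [u, gaussBinom_eq_zero_of_lt x (by lia : 2 * n < n + (3 * M + s)), mul_zero]
    have hstep (m : ℕ) :
        x ^ (6 * m ^ 2 + 4 * s * m + (3 * m + s)) * centralPair x (n + 1) (3 * m + s) =
          x ^ (6 * m ^ 2 + 4 * s * m + (3 * m + s)) * centralPair x n (3 * m + s)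
          + (u m - u (m + 1)) := by
      simp only [u, show n + (3 * (m + 1) + s) = n + (3 * m + s) + 3 by ring]
      linear_combination x ^ (6 * m ^ 2 + 4 * s * m) * pow_mul_centralPair_succ x n (3 * m + s)
    simp only [hstep]
    rw [Finset.sum_add_distrib, Finset.sum_range_sub', ← ih (by lia), hu₀, huM, sub_zero,
      centralSum, centralSum, Finset.sum_range_succ]

lemma sum_pow_mul_gaussCatalan (n : ℕ) :
    ∑ k ∈ Finset.range n, x ^ k * gaussCatalan x k = centralSum x 0 n - x * centralSum x 1 n := by
  rw [centralSum, centralSum, Finset.mul_sum, ← Finset.sum_sub_distrib]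
  refine Finset.sum_congr rfl fun k _ => ?_
  rw [gaussCatalan, add_zero]
  ring

end CentralSum

section RatFunc

lemma one_sub_q_pow_ne_zero {n : ℕ} (hn : n ≠ 0) : 1 - q ^ n ≠ 0 := by
  have h : (1 - X ^ n : ℤ[X]) ≠ 0 :=
    neg_sub (X ^ n : ℤ[X]) 1 ▸ neg_ne_zero.2 (X_pow_sub_C_ne_zero (Nat.pos_of_ne_zero hn) 1)
  simpa [q] using (map_ne_zero_iff _ (IsFractionRing.injective ℤ[X] (RatFunc ℤ))).2 h

lemma qShifted_q_ne_zero (n : ℕ) : qShifted q n ≠ 0 := by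
  refine Finset.prod_ne_zero_iff.2 fun i _ => ?_
  rw [← pow_succ']
  exact one_sub_q_pow_ne_zero i.succ_ne_zero

lemma qShifted_q_succ (n : ℕ) : qShifted q (n + 1) = qShifted q n * (1 - q ^ (n + 1)) := by
  rw [qShifted, Finset.prod_range_succ, ← pow_succ', ← qShifted]

lemma gaussBinom_mul_qShifted (a b : ℕ) :
    gaussBinom q (a + b) a * (qShifted q a * qShifted q b) = qShifted q (a + b) := by
  induction a with
  | zero => simp [qShifted]
  | succ a ih =>
    rw [show a + 1 + b = a + b + 1 by ring, qShifted_q_succ a, qShifted_q_succ (a + b), ← ih]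
    linear_combination qShifted q a * qShifted q b *
      one_sub_pow_mul_gaussBinom_succ_succ q (a + b) a

lemma qBinom_eq_gaussBinom (n k : ℕ) : qBinom n k = gaussBinom q n k := by
  unfold qBinom
  split_ifs with h
  · obtain ⟨b, rfl⟩ := Nat.exists_eq_add_of_le h
    rw [Nat.add_sub_cancel_left, div_eq_iff
      (mul_ne_zero (qShifted_q_ne_zero _) (qShifted_q_ne_zero _)), gaussBinom_mul_qShifted]
  · rw [gaussBinom_eq_zero_of_lt _ (not_le.1 h)]

lemma qCatalan_eq_gaussCatalan (k : ℕ) : qCatalan k = gaussCatalan q k := by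
  have h₁ : 1 - q ^ (k + 1) ≠ 0 := one_sub_q_pow_ne_zero k.succ_ne_zero
  have h₂ : 1 - q ≠ 0 := by simpa using one_sub_q_pow_ne_zero one_ne_zero
  have h := one_sub_pow_sub_mul_gaussBinom q (2 * k) k
  rw [show 2 * k - k = k by lia] at h
  rw [qCatalan, qInt, qBinom_eq_gaussBinom, gaussCatalan, div_eq_iff (div_ne_zero h₁ h₂),
    mul_div_assoc', eq_div_iff h₂]
  linear_combination -q * h

lemma qCongr_sum_qCatalan {n : ℕ} {f P : ℤ[X]}
    (h : P ∣ ∑ k ∈ Finset.range n, X ^ k * gaussCatalan X k - f) :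
    QCongr (∑ k ∈ Finset.range n, q ^ k * qCatalan k) (algebraMap ℤ[X] (RatFunc ℤ) f) P := by
  obtain ⟨g, hg⟩ := h
  refine ⟨g, ?_⟩
  rw [← hg, map_sub, map_sum]
  simp only [map_mul, map_pow, map_gaussCatalan, RatFunc.algebraMap_X, qCatalan_eq_gaussCatalan, q]

end RatFunc

section DualNumber

open scoped DualNumber

/-- The point `z (1 + ε)` of the dual numbers. A polynomial `f` takes there the value
`f(z) + z f'(z) ε`, and in particular `q ^ n` takes the value `1 + n ε` when `z ^ n = 1`. -/
def dualPoint {R : Type*} [CommRing R] (z : R) : R[ε] := z • (1 + ε)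

variable {R : Type*} [CommRing R]

@[simp]
lemma fst_dualPoint (z : R) : (dualPoint z).fst = z := by simp [dualPoint]

lemma dualPoint_pow (z : R) (n : ℕ) : dualPoint z ^ n = z ^ n • (1 + (n : R) • ε) := by
  rw [dualPoint, _root_.smul_pow]
  congr 1
  induction n with
  | zero => simp
  | succ n ih =>
    rw [pow_succ, ih]
    ext <;> simp [add_comm]

lemma mul_smul_eps (x : R[ε]) (c : R) : x * c • (ε : R[ε]) = (x.fst * c) • ε := by
  ext <;> simp [mul_comm]

lemma aeval_dualPoint {A : Type*} [CommRing A] [Algebra A R] (z : R) (f : A[X]) :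
    aeval (dualPoint z) f = aeval z f • (1 : R[ε]) + (z * aeval z (derivative f)) • ε := by
  have h := aeval_add_of_sq_eq_zero f (algebraMap R R[ε] z) (z • ε) (by simp [sq])
  rw [dualPoint, smul_add, ← Algebra.algebraMap_eq_smul_one, h]
  simp only [aeval_algebraMap_apply]
  ext <;> simp [TrivSqZeroExt.algebraMap_eq_inl, mul_comm]

/- As `z` is a simple root of its minimal polynomial `p`, a polynomial `p * g` which vanishes to
second order at `z` has `g` vanish at `z`. -/
theorem minpoly_sq_dvd {A : Type*} [CommRing A] [IsDomain A] [IsIntegrallyClosed A] [CharZero A]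
    [IsDomain R] [Algebra A R] [Module.IsTorsionFree A R] {z : R}
    (hz : IsIntegral A z) (hz₀ : z ≠ 0) {f : A[X]} (hf : aeval (dualPoint z) f = 0) :
    minpoly A z ^ 2 ∣ f := by
  rw [aeval_dualPoint] at hf
  have hf₀ : aeval z f = 0 := by simpa using congrArg TrivSqZeroExt.fst hf
  have hf₁ : aeval z (derivative f) = 0 := by
    simpa [hz₀] using congrArg TrivSqZeroExt.snd hf
  obtain ⟨g, rfl⟩ := minpoly.isIntegrallyClosed_dvd hz hf₀
  have hsimple : aeval z (derivative (minpoly A z)) ≠ 0 := fun h =>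
    (degree_derivative_lt (minpoly.ne_zero hz)).not_ge
      (minpoly.IsIntegrallyClosed.degree_le_of_ne_zero
        (derivative_ne_zero.2 (minpoly.natDegree_pos hz).ne') h)
  have hg : aeval z g = 0 := by simpa [hsimple] using hf₁
  rw [sq]
  exact mul_dvd_mul_left _ (minpoly.isIntegrallyClosed_dvd hz hg)

end DualNumber

section RootOfUnity

lemma pow_mul_gaussBinom_sq_of_pow_eq_one {R : Type*} [CommRing R] [IsDomain R] {y : R} {k d : ℕ}
    (hk : (y ^ 2) ^ (k + d + 1) = 1) (hd : ∀ i, 0 < i → i ≤ d → (y ^ 2) ^ i ≠ 1) :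
    y ^ (d * (d + 1)) * gaussBinom (y ^ 2) (k + d) k = (-1) ^ d := by
  induction d generalizing k with
  | zero => simp
  | succ d ih =>
    have h := one_sub_pow_sub_mul_gaussBinom (y ^ 2) (k + (d + 1)) k
    rw [show k + (d + 1) - k = d + 1 by lia] at h
    have hinv : (y ^ 2) ^ (k + 1) * (y ^ 2) ^ (d + 1) = 1 := by rw [← pow_add, ← hk]; ring
    have ih := ih (k := k + 1) (by rw [← hk]; ring) fun i h₀ h₁ => hd i h₀ (h₁.trans d.le_succ)
    rw [show k + 1 + d = k + (d + 1) by ring] at ih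
    refine mul_left_cancel₀ (sub_ne_zero.2 (hd (d + 1) d.succ_pos le_rfl).symm) ?_
    rw [pow_succ (-1 : R), ← ih]
    linear_combination y ^ ((d + 1) * (d + 2)) * h
      - y ^ (d * (d + 1)) * gaussBinom (y ^ 2) (k + (d + 1)) (k + 1) * hinv

variable {K : Type*} [Field K] {η : K} {n : ℕ} [NeZero n]

lemma pow_half_eq_neg_one (hη : IsPrimitiveRoot η (2 * n)) : η ^ n = -1 :=
  (hη.pow (NeZero.pos _) (mul_comm 2 n)).eq_neg_one_of_two_right

lemma zpow_add_half (hη : IsPrimitiveRoot η (2 * n)) (a : ℤ) : η ^ (a + n) = -η ^ a := by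
  rw [zpow_add₀ (hη.ne_zero (NeZero.ne _)), zpow_natCast, pow_half_eq_neg_one hη, mul_neg_one]

lemma gaussBinom_two_mul_sub_one (hη : IsPrimitiveRoot η (2 * n)) {j : ℕ} (hj₀ : 0 < j)
    (hj : j ≤ n) :
    gaussBinom (η ^ 2) (2 * n - 1) (n + j - 1) = -η ^ (n * j - j * (j - 1) : ℤ) := by
  have h₀ : η ≠ 0 := hη.ne_zero (NeZero.ne _)
  obtain ⟨d, rfl⟩ := Nat.exists_eq_add_of_le hj
  have hz : IsPrimitiveRoot (η ^ 2) (j + d) := hη.pow (NeZero.pos _) rfl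
  have h := pow_mul_gaussBinom_sq_of_pow_eq_one (y := η) (k := j + d + j - 1) (d := d)
    (by rw [show j + d + j - 1 + d + 1 = 2 * (j + d) by lia, pow_mul', hz.pow_eq_one, one_pow])
    fun i hi₀ hi => hz.pow_ne_one_of_pos_of_lt hi₀.ne' (by lia)
  rw [show j + d + j - 1 + d = 2 * (j + d) - 1 by lia] at h
  rw [show ((j + d : ℕ) * j - j * (j - 1) : ℤ) = (j * (d + 1) : ℕ) by push_cast; ring, zpow_natCast]
  refine mul_left_cancel₀ (pow_ne_zero (d * (d + 1)) h₀) ?_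
  rw [h, mul_neg, ← pow_add, ← add_mul, add_comm d, pow_mul, pow_half_eq_neg_one hη, pow_succ,
    mul_neg_one, neg_neg]

/-- The summand `η ^ a / (1 - η ^ (2 * b))` of an Appell-Lerch type sum; the exponents are integers,
as they are only relevant modulo the order of `η`. -/
def lerchTerm (η : K) (a b : ℤ) : K := η ^ a / (1 - η ^ (2 * b))

lemma lerchTerm_congr (hη : IsPrimitiveRoot η (2 * n)) {a a' b b' : ℤ} (c d : ℤ)
    (ha : a = a' + 2 * n * c) (hb : b = b' + n * d) : lerchTerm η a b = lerchTerm η a' b' := by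
  have hper (e k : ℤ) : η ^ (e + 2 * n * k) = η ^ e := by
    have h : η ^ (2 * n : ℤ) = 1 := mod_cast hη.pow_eq_one
    rw [zpow_add₀ (hη.ne_zero (NeZero.ne _)), zpow_mul, h, one_zpow, mul_one]
  rw [lerchTerm, lerchTerm, ha, hb, mul_add, ← mul_assoc, hper, hper]

lemma lerchTerm_add_half (hη : IsPrimitiveRoot η (2 * n)) (a b : ℤ) :
    lerchTerm η (a + n) b = -lerchTerm η a b := by
  rw [lerchTerm, zpow_add_half hη, neg_div, lerchTerm]

lemma lerchTerm_neg (hη : IsPrimitiveRoot η (2 * n)) (a b : ℤ) :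
    lerchTerm η a (-b) = lerchTerm η (a + 2 * b + n) b := by
  have h₀ : η ≠ 0 := hη.ne_zero (NeZero.ne _)
  rw [lerchTerm, lerchTerm, zpow_add_half hη, zpow_add₀ h₀, mul_neg, zpow_neg]
  have h₁ : η ^ (2 * b) ≠ 0 := zpow_ne_zero _ h₀
  rw [← mul_div_mul_right _ _ h₁, sub_mul, inv_mul_cancel₀ h₁, one_mul, neg_div, ← div_neg, neg_sub]

section Dual

open scoped DualNumber

lemma gaussBinom_dualPoint (hη : IsPrimitiveRoot η (2 * n)) {j : ℕ} (hj₀ : 0 < j) (hj : j < n) :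
    gaussBinom (dualPoint (η ^ 2)) (2 * n) (n + j) =
      (2 * n * lerchTerm η (n * j - j * (j - 1)) j) • ε := by
  have hz : IsPrimitiveRoot (η ^ 2) n := hη.pow (NeZero.pos _) rfl
  have hj₁ : 1 - (η ^ 2) ^ j ≠ 0 := sub_ne_zero.2 (hz.pow_ne_one_of_pos_of_lt hj₀.ne' hj).symm
  have hzj : (η ^ 2) ^ (n + j) = (η ^ 2) ^ j := by rw [pow_add, hz.pow_eq_one, one_mul]
  have hunit : IsUnit (1 - dualPoint (η ^ 2) ^ (n + j)) := by
    rw [TrivSqZeroExt.isUnit_iff_isUnit_fst]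
    simpa [hzj] using hj₁
  have hfst : (gaussBinom (dualPoint (η ^ 2)) (2 * n - 1) (n + j - 1)).fst =
      -η ^ (n * j - j * (j - 1) : ℤ) := by
    rw [← gaussBinom_two_mul_sub_one hη hj₀ hj.le]
    simpa using map_gaussBinom (dualPoint (η ^ 2)) (TrivSqZeroExt.fstHom K K K) _ _
  have h := one_sub_pow_mul_gaussBinom_succ_succ (dualPoint (η ^ 2)) (2 * n - 1) (n + j - 1)
  rw [show n + j - 1 + 1 = n + j by lia, show 2 * n - 1 + 1 = 2 * n by lia,
    dualPoint_pow _ (2 * n), pow_mul', hz.pow_eq_one, one_pow, one_smul, sub_add_cancel_left] at h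
  refine hunit.mul_left_cancel (h.trans ?_)
  have hdiv (c d : K) : (1 - (η ^ 2) ^ j) * (c * (d / (1 - (η ^ 2) ^ j))) = c * d := by
    field_simp
  have hexp : η ^ (2 * j : ℤ) = (η ^ 2) ^ j := by rw [← pow_mul]; norm_cast
  rw [mul_comm, mul_neg, mul_smul_eps, mul_smul_eps, hfst, TrivSqZeroExt.fst_sub,
    TrivSqZeroExt.fst_one, TrivSqZeroExt.fst_pow, fst_dualPoint, hzj, lerchTerm, hexp,
    hdiv, ← neg_smul, neg_mul, neg_neg, mul_comm, Nat.cast_mul, Nat.cast_ofNat]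

lemma dualPoint_pow_mul_gaussBinom (hη : IsPrimitiveRoot η (2 * n)) {j : ℕ} (hj₀ : 0 < j)
    (hj : j < n) (e : ℕ) :
    dualPoint (η ^ 2) ^ e * gaussBinom (dualPoint (η ^ 2)) (2 * n) (n + j) =
      (2 * n * lerchTerm η (2 * e + n * j - j * (j - 1)) j) • ε := by
  have hpow : η ^ (2 * e + n * j - j * (j - 1) : ℤ) =
      (η ^ 2) ^ e * η ^ (n * j - j * (j - 1) : ℤ) := by
    rw [add_sub_assoc, zpow_add₀ (hη.ne_zero (NeZero.ne _)), ← pow_mul]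
    norm_cast
  rw [gaussBinom_dualPoint hη hj₀ hj, mul_smul_eps, TrivSqZeroExt.fst_pow, fst_dualPoint, lerchTerm,
    lerchTerm, hpow]
  ring_nf

/-- The `ε`-coefficient of the `m`-th summand of `centralSum_eq_sum_centralPair`, up to a factor
`2 n`. -/
def pairTerm (η : K) (n s m : ℕ) : K :=
  lerchTerm η (3 * m ^ 2 + 3 * m + 2 * m * s + s - s ^ 2 + n * (m + s + 1)) (3 * m + s + 1) +
  lerchTerm η (3 * m ^ 2 + 3 * m + 2 * m * s + s - s ^ 2 + n * (m + s)) (-(3 * m + s + 2))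

lemma dualPoint_pow_mul_centralPair (hη : IsPrimitiveRoot η (2 * n)) {s m : ℕ}
    (h : 3 * m + s + 2 < n) :
    dualPoint (η ^ 2) ^ (6 * m ^ 2 + 4 * s * m + (3 * m + s)) *
      centralPair (dualPoint (η ^ 2)) n (3 * m + s) = (2 * n * pairTerm η n s m) • ε := by
  have h₁ := dualPoint_pow_mul_gaussBinom hη (j := 3 * m + s + 1) (by lia) (by lia)
    (6 * m ^ 2 + 4 * s * m + (3 * m + s))
  have h₂ := dualPoint_pow_mul_gaussBinom hη (j := 3 * m + s + 2) (by lia) h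
    (6 * m ^ 2 + 4 * s * m + (3 * m + s) + (2 * (3 * m + s) + 3))
  rw [centralPair, mul_sub, ← mul_assoc, ← pow_add, add_assoc n, add_assoc n, h₁, h₂,
    pairTerm, lerchTerm_neg hη, ← sub_smul, ← mul_sub, sub_eq_add_neg, ← lerchTerm_add_half hη]
  congr 3
  · exact lerchTerm_congr hη m 0 (by push_cast; ring) (by push_cast; ring)
  · exact lerchTerm_congr hη (m + 1) 0 (by push_cast; ring) (by push_cast; ring)

end Dual

end RootOfUnity

section AlternatingSum

variable {K : Type*} [Field K] {h : K}

/-- The summand of the alternating sum `∑ (-1) ^ l * h ^ (l * (l + 1 - 2 * N)) / (1 - h ^ (2 * l))`,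
whose value over `1 ≤ l ≤ 2 * N` or `1 ≤ l ≤ 2 * N - 1` satisfies a simple recursion in `N`. -/
def altTerm (h : K) (N : ℕ) (l : ℤ) : K := (-1) ^ l * h ^ (l * (l + 1 - 2 * N)) / (1 - h ^ (2 * l))

lemma altTerm_succ_sub_altTerm (hh : h ≠ 0) (N : ℕ) {l : ℤ} (hl : h ^ (2 * l) ≠ 1) :
    altTerm h (N + 1) l - altTerm h N l = (-1) ^ l * h ^ (l * (l - 1 - 2 * N)) := by
  have hl' : 1 - h ^ (2 * l) ≠ 0 := sub_ne_zero.2 hl.symm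
  rw [altTerm, altTerm, ← sub_div, div_eq_iff hl',
    show l * (l + 1 - 2 * (N + 1 : ℕ)) = l * (l - 1 - 2 * N) by push_cast; ring,
    show l * (l + 1 - 2 * N) = l * (l - 1 - 2 * N) + 2 * l by ring, zpow_add₀ hh]
  ring

lemma sum_neg_one_pow_mul_zpow_eq_zero (h : K) (N : ℕ) :
    ∑ i ∈ Finset.range (2 * N), (-1) ^ (i + 1) * h ^ ((i + 1) * (i - 2 * N) : ℤ) = 0 := by
  have hcancel {i j : ℕ} (hij : i + j + 1 = 2 * N) :
      (-1) ^ (i + 1) * h ^ ((i + 1) * (i - 2 * N) : ℤ) +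
        (-1) ^ (j + 1) * h ^ ((j + 1) * (j - 2 * N) : ℤ) = 0 := by
    have hsign : (-1 : K) ^ (j + 1) = -(-1) ^ (i + 1) := by
      rcases Nat.even_or_odd i with hi | hi
      · rw [hi.add_one.neg_one_pow, Even.neg_one_pow (by grind), neg_neg]
      · rw [hi.add_one.neg_one_pow, Odd.neg_one_pow (by grind)]
    have hN : (2 * N : ℤ) = i + j + 1 := mod_cast hij.symm
    rw [hsign, hN, show ((j + 1) * (j - (i + j + 1)) : ℤ) = (i + 1) * (i - (i + j + 1)) by ring,
      neg_mul, add_neg_cancel]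
  refine Finset.sum_involution (fun i _ => 2 * N - 1 - i) (fun i hi => ?_) ?_ ?_ ?_
  · exact hcancel (by rw [Finset.mem_range] at hi; lia)
  all_goals simp only [Finset.mem_range]; lia

lemma sum_altTerm_succ (hh : h ≠ 0) {N : ℕ} (hN : ∀ l, 0 < l → l ≤ 2 * N → (h ^ 2) ^ l ≠ 1) :
    ∑ i ∈ Finset.range (2 * N), altTerm h (N + 1) (i + 1) =
      ∑ i ∈ Finset.range (2 * N), altTerm h N (i + 1) := by
  rw [← sub_eq_zero, ← Finset.sum_sub_distrib, ← sum_neg_one_pow_mul_zpow_eq_zero h N]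
  refine Finset.sum_congr rfl fun i hi => ?_
  have hi' : h ^ (2 * (i + 1) : ℤ) ≠ 1 := by
    have := hN (i + 1) i.succ_pos (Finset.mem_range.1 hi)
    rw [← pow_mul] at this
    exact_mod_cast this
  rw [altTerm_succ_sub_altTerm hh N hi', add_sub_cancel_right]
  norm_cast

lemma altTerm_succ_two_mul_add_one (h : K) (N : ℕ) :
    altTerm h (N + 1) (2 * N + 1) = -(1 - (h ^ 2) ^ (2 * N + 1))⁻¹ := by
  have hsign : (-1 : K) ^ (2 * N + 1 : ℤ) = -1 := Odd.neg_one_zpow ⟨N, rfl⟩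
  have hexp : h ^ (2 * (2 * N + 1) : ℤ) = (h ^ 2) ^ (2 * N + 1) := by rw [← pow_mul]; norm_cast
  rw [altTerm, hsign, hexp, show (2 * N + 1 + 1 - 2 * (N + 1 : ℕ) : ℤ) = 0 by push_cast; ring,
    mul_zero, zpow_zero, mul_one, neg_div, one_div]

lemma altTerm_two_mul {N : ℕ} (hN : (h ^ 2) ^ N ≠ 1) (hN' : (h ^ 2) ^ (2 * N) ≠ 1) :
    altTerm h N (2 * N) = (1 - (h ^ 2) ^ N)⁻¹ - (1 - (h ^ 2) ^ (2 * N))⁻¹ := by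
  have hsign : (-1 : K) ^ (2 * N : ℤ) = 1 := Even.neg_one_zpow ⟨N, two_mul _⟩
  have hexp : h ^ (2 * (2 * N) : ℤ) = (h ^ 2) ^ (2 * N) := by rw [← pow_mul]; norm_cast
  have hexp' : h ^ (2 * N : ℤ) = (h ^ 2) ^ N := by rw [← pow_mul]; norm_cast
  have h₁ : 1 - (h ^ 2) ^ N ≠ 0 := sub_ne_zero.2 hN.symm
  have h₂ : 1 - (h ^ 2) ^ (2 * N) ≠ 0 := sub_ne_zero.2 hN'.symm
  rw [altTerm, hsign, hexp, show (2 * N * (2 * N + 1 - 2 * N) : ℤ) = 2 * N by ring, hexp', one_mul,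
    inv_sub_inv h₁ h₂, div_eq_div_iff h₂ (mul_ne_zero h₁ h₂)]
  ring

theorem sum_altTerm_even (hh : h ≠ 0) {N : ℕ} (hN : ∀ l, 0 < l → l ≤ 2 * N → (h ^ 2) ^ l ≠ 1) :
    ∑ i ∈ Finset.range (2 * N), altTerm h N (i + 1) =
      -∑ l ∈ Finset.Ioc N (2 * N), (1 - (h ^ 2) ^ l)⁻¹ := by
  induction N with
  | zero => simp
  | succ N ih =>
    have ih := ih fun l h₀ h₁ => hN l h₀ (by lia)
    have h₁ := altTerm_succ_two_mul_add_one h N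
    have h₂ := altTerm_two_mul (hN (N + 1) (by lia) (by lia)) (hN (2 * (N + 1)) (by lia) le_rfl)
    have hIoc := Finset.sum_Ioc_consecutive (fun l => (1 - (h ^ 2) ^ l)⁻¹) (Nat.le_add_right N 1)
      (show N + 1 ≤ 2 * N + 2 by lia)
    rw [Nat.Ioc_succ_singleton, Finset.sum_singleton, Finset.sum_Ioc_succ_top (a := N) (by lia),
      Finset.sum_Ioc_succ_top (a := N) (by lia)] at hIoc
    rw [mul_add_one, Finset.sum_range_succ, Finset.sum_range_succ,
      sum_altTerm_succ hh fun l h₀ h₁ => hN l h₀ (by lia), ih]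
    push_cast at h₁ h₂ ⊢
    rw [show (2 * N + 1 + 1 : ℤ) = 2 * (N + 1) by ring, h₁, h₂]
    linear_combination hIoc

theorem sum_altTerm_odd (hh : h ≠ 0) {N : ℕ} (hN : ∀ l, 0 < l → l ≤ 2 * N → (h ^ 2) ^ l ≠ 1) :
    ∑ i ∈ Finset.range (2 * N + 1), altTerm h (N + 1) (i + 1) =
      -∑ l ∈ Finset.Ioc N (2 * N + 1), (1 - (h ^ 2) ^ l)⁻¹ := by
  have hlast := altTerm_succ_two_mul_add_one h N
  rw [Finset.sum_range_succ, sum_altTerm_succ hh hN, sum_altTerm_even hh hN,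
    Finset.sum_Ioc_succ_top (by lia), neg_add]
  push_cast
  rw [hlast]

lemma two_mul_sum_inv_one_sub_pow {x : K} {a b : ℕ} (hab : a ≤ b) (hx : x ^ (a + b + 1) = 1)
    (hne : ∀ l ∈ Finset.Ioc a b, x ^ l ≠ 1) :
    2 * ∑ l ∈ Finset.Ioc a b, (1 - x ^ l)⁻¹ = b - a := by
  have hreflect : ∑ l ∈ Finset.Ioc a b, (1 - x ^ l)⁻¹ =
      ∑ l ∈ Finset.Ioc a b, (1 - x ^ (a + b + 1 - l))⁻¹ := by
    refine Finset.sum_nbij' (fun l => a + b + 1 - l) (fun l => a + b + 1 - l) ?_ ?_ ?_ ?_ ?_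
    all_goals grind
  have hpair (l : ℕ) (hl : l ∈ Finset.Ioc a b) :
      (1 - x ^ l)⁻¹ + (1 - x ^ (a + b + 1 - l))⁻¹ = 1 := by
    have hne₀ : 1 - x ^ l ≠ 0 := sub_ne_zero.2 (hne l hl).symm
    have hinv : x ^ l * x ^ (a + b + 1 - l) = 1 := by
      rw [← pow_add, Nat.add_sub_cancel' (by simp at hl; lia), hx]
    have hx₀ : x ^ l ≠ 0 := left_ne_zero_of_mul_eq_one hinv
    have hne₁ : x ^ l - 1 ≠ 0 := sub_ne_zero.2 (hne l hl)
    rw [eq_inv_of_mul_eq_one_right hinv]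
    field_simp
    ring
  rw [two_mul]
  nth_rw 2 [hreflect]
  rw [← Finset.sum_add_distrib, Finset.sum_congr rfl hpair]
  simp [hab]

end AlternatingSum

section Rearrangement

variable {M : Type*} [AddCommMonoid M] (f : ℤ → M) (N : ℕ)

lemma sum_range_two_mul_eq_sum_center :
    ∑ i ∈ Finset.range (2 * N), f (i + 1) =
      ∑ m ∈ Finset.range N, (f (N - m) + f (N + m + 1)) := by
  rw [two_mul, Finset.sum_range_add, ← Finset.sum_range_reflect, ← Finset.sum_add_distrib]
  refine Finset.sum_congr rfl fun m hm => ?_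
  rw [Finset.mem_range] at hm
  congr 2
  lia

lemma sum_range_two_mul_eq_sum_ends :
    ∑ i ∈ Finset.range (2 * N), f (i + 1) =
      ∑ m ∈ Finset.range N, (f (m + 1) + f (2 * N - m)) := by
  rw [sum_range_two_mul_eq_sum_center, ← Finset.sum_range_reflect]
  refine Finset.sum_congr rfl fun m hm => ?_
  rw [Finset.mem_range] at hm
  congr 2 <;> lia

end Rearrangement

section Evaluation

variable {K : Type*} [Field K] {η : K} {n N : ℕ}

lemma cube_sq_pow_eq_one (hη : IsPrimitiveRoot η (2 * n)) : ((η ^ 3) ^ 2) ^ n = 1 := by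
  rw [← pow_mul, ← pow_mul, pow_mul', hη.pow_eq_one, one_pow]

lemma cube_sq_pow_ne_one (hη : IsPrimitiveRoot η (2 * n)) (hn : ¬ 3 ∣ n) {l : ℕ} (hl₀ : 0 < l)
    (hl : 3 * l < 2 * n) : ((η ^ 3) ^ 2) ^ l ≠ 1 := by
  rw [← pow_mul, ← pow_mul, Ne, hη.pow_eq_one_iff_dvd]
  rintro ⟨c, hc⟩
  obtain rfl : c = 1 := by nlinarith
  lia

variable [NeZero n]

lemma zpow_mul_altTerm_cube (hη : IsPrimitiveRoot η (2 * n)) (c l : ℤ) (N : ℕ) :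
    η ^ c * altTerm (η ^ 3) N l = lerchTerm η (c + n * l + 3 * l * (l + 1 - 2 * N)) (3 * l) := by
  have h₀ : η ≠ 0 := hη.ne_zero (NeZero.ne _)
  have hcube (e : ℤ) : (η ^ 3) ^ e = η ^ (3 * e) := by rw [zpow_mul]; norm_cast
  rw [altTerm, lerchTerm, hcube, hcube, ← pow_half_eq_neg_one hη, ← zpow_natCast η n, ← zpow_mul,
    ← mul_div_assoc, ← zpow_add₀ h₀, ← zpow_add₀ h₀]
  ring_nf

lemma two_mul_sum_altTerm_cube_of_eq_one (hη : IsPrimitiveRoot η (2 * n)) (hn : n = 3 * N + 1) :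
    2 * ∑ i ∈ Finset.range (2 * N), altTerm (η ^ 3) N (i + 1) = -N := by
  have hne (l : ℕ) (hl₀ : 0 < l) (hl : l ≤ 2 * N) : ((η ^ 3) ^ 2) ^ l ≠ 1 :=
    cube_sq_pow_ne_one hη (by lia) hl₀ (by lia)
  have hone : ((η ^ 3) ^ 2) ^ (N + 2 * N + 1) = 1 := by
    rw [show N + 2 * N + 1 = n by lia, cube_sq_pow_eq_one hη]
  have h := two_mul_sum_inv_one_sub_pow (by lia) hone
    fun l hl => hne l (N.zero_le.trans_lt (Finset.mem_Ioc.1 hl).1) (Finset.mem_Ioc.1 hl).2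
  rw [sum_altTerm_even (pow_ne_zero 3 (hη.ne_zero (NeZero.ne _))) hne, mul_neg, h]
  push_cast
  ring

lemma two_mul_sum_altTerm_cube_of_eq_two (hη : IsPrimitiveRoot η (2 * n)) (hn : n = 3 * N + 2) :
    2 * ∑ i ∈ Finset.range (2 * N + 1), altTerm (η ^ 3) (N + 1) (i + 1) = -(N + 1) := by
  have hne (l : ℕ) (hl₀ : 0 < l) (hl : l ≤ 2 * N + 1) : ((η ^ 3) ^ 2) ^ l ≠ 1 :=
    cube_sq_pow_ne_one hη (by lia) hl₀ (by lia)
  have hone : ((η ^ 3) ^ 2) ^ (N + (2 * N + 1) + 1) = 1 := by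
    rw [show N + (2 * N + 1) + 1 = n by lia, cube_sq_pow_eq_one hη]
  have h := two_mul_sum_inv_one_sub_pow (by lia) hone
    fun l hl => hne l (N.zero_le.trans_lt (Finset.mem_Ioc.1 hl).1) (Finset.mem_Ioc.1 hl).2
  rw [sum_altTerm_odd (pow_ne_zero 3 (hη.ne_zero (NeZero.ne _)))
    fun l hl₀ hl => hne l hl₀ (hl.trans (Nat.le_succ _)), mul_neg, h]
  push_cast
  ring

lemma pairTerm_zero_of_eq_one (hη : IsPrimitiveRoot η (2 * n)) (hn : n = 3 * N + 1) (m : ℕ) :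
    pairTerm η n 0 m =
      η ^ (2 * N : ℤ) * (altTerm (η ^ 3) N (N - m) + altTerm (η ^ 3) N (N + m + 1)) := by
  have hN : (n : ℤ) = 3 * N + 1 := mod_cast hn
  rw [mul_add, zpow_mul_altTerm_cube hη, zpow_mul_altTerm_cube hη, pairTerm]
  congr 1
  · rw [← neg_neg (3 * (m : ℤ) + _ + 1), lerchTerm_neg hη]
    exact lerchTerm_congr hη m (-1) (by rw [hN]; push_cast; ring) (by rw [hN]; push_cast; ring)
  · rw [lerchTerm_neg hη]
    exact lerchTerm_congr hη (-1) (-1) (by rw [hN]; push_cast; ring) (by rw [hN]; push_cast; ring)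

lemma pairTerm_one_of_eq_one (hη : IsPrimitiveRoot η (2 * n)) (hn : n = 3 * N + 1) (m : ℕ) :
    pairTerm η n 1 m =
      η ^ (n - 2 : ℤ) * (altTerm (η ^ 3) N (m + 1) + altTerm (η ^ 3) N (2 * N - m)) := by
  have hN : (n : ℤ) = 3 * N + 1 := mod_cast hn
  rw [add_comm (altTerm _ _ _), mul_add, zpow_mul_altTerm_cube hη, zpow_mul_altTerm_cube hη,
    pairTerm]
  congr 1
  · rw [← neg_neg (3 * (m : ℤ) + _ + 1), lerchTerm_neg hη]
    exact lerchTerm_congr hη (2 * m - N) (-2) (by rw [hN]; push_cast; ring)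
      (by rw [hN]; push_cast; ring)
  · rw [lerchTerm_neg hη]
    exact lerchTerm_congr hη (m + 1) 0 (by rw [hN]; push_cast; ring) (by push_cast; ring)

lemma pairTerm_zero_of_eq_two (hη : IsPrimitiveRoot η (2 * n)) (hn : n = 3 * N + 2) (m : ℕ) :
    pairTerm η n 0 m =
      η ^ (N : ℤ) * (altTerm (η ^ 3) (N + 1) (N - m) + altTerm (η ^ 3) (N + 1) (N + m + 1)) := by
  have hN : (n : ℤ) = 3 * N + 2 := mod_cast hn
  rw [add_comm (altTerm _ _ _), mul_add, zpow_mul_altTerm_cube hη, zpow_mul_altTerm_cube hη,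
    pairTerm]
  congr 1
  · exact lerchTerm_congr hη 0 (-1) (by rw [hN]; push_cast; ring) (by rw [hN]; push_cast; ring)
  · exact lerchTerm_congr hη m (-1) (by rw [hN]; push_cast; ring) (by rw [hN]; push_cast; ring)

lemma sum_pairTerm_one_of_eq_two (hη : IsPrimitiveRoot η (2 * n)) (hn : n = 3 * N + 2) :
    ∑ m ∈ Finset.range N, pairTerm η n 1 m = 0 := by
  have hN : (n : ℤ) = 3 * N + 2 := mod_cast hn
  simp only [pairTerm]
  rw [Finset.sum_add_distrib, ← Finset.sum_range_reflect, ← Finset.sum_add_distrib]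
  refine Finset.sum_eq_zero fun m hm => ?_
  have hm' : ((N - 1 - m : ℕ) : ℤ) = N - 1 - m := by rw [Finset.mem_range] at hm; lia
  rw [hm', add_eq_zero_iff_eq_neg, ← lerchTerm_add_half hη]
  exact lerchTerm_congr hη (N - 1 - 2 * m) 1 (by rw [hN]; push_cast; ring)
    (by rw [hN]; push_cast; ring)

lemma two_mul_sum_pairTerm_zero_of_eq_one (hη : IsPrimitiveRoot η (2 * n)) (hn : n = 3 * N + 1) :
    2 * ∑ m ∈ Finset.range N, pairTerm η n 0 m = -(N * (η ^ 2) ^ N) := by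
  have h := two_mul_sum_altTerm_cube_of_eq_one hη hn
  rw [sum_range_two_mul_eq_sum_center (altTerm (η ^ 3) N)] at h
  have hexp : η ^ (2 * N : ℤ) = (η ^ 2) ^ N := by rw [← pow_mul]; norm_cast
  simp only [pairTerm_zero_of_eq_one hη hn]
  rw [← Finset.mul_sum, hexp]
  linear_combination (η ^ 2) ^ N * h

lemma two_mul_sum_pairTerm_one_of_eq_one (hη : IsPrimitiveRoot η (2 * n)) (hn : n = 3 * N + 1) :
    2 * (η ^ 2 * ∑ m ∈ Finset.range N, pairTerm η n 1 m) = N := by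
  have h := two_mul_sum_altTerm_cube_of_eq_one hη hn
  rw [sum_range_two_mul_eq_sum_ends (altTerm (η ^ 3) N)] at h
  have hexp : η ^ 2 * η ^ (n - 2 : ℤ) = -1 := by
    rw [← pow_half_eq_neg_one hη, ← zpow_natCast, ← zpow_natCast,
      ← zpow_add₀ (hη.ne_zero (NeZero.ne _))]
    congr 1
    push_cast
    ring
  simp only [pairTerm_one_of_eq_one hη hn]
  rw [← Finset.mul_sum, ← mul_assoc (η ^ 2), hexp]
  linear_combination -h

lemma two_mul_sum_pairTerm_zero_of_eq_two (hη : IsPrimitiveRoot η (2 * n)) (hn : n = 3 * N + 2) :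
    2 * (∑ m ∈ Finset.range N, pairTerm η n 0 m +
      lerchTerm η (2 * (6 * N ^ 2 + 3 * N) + n * (3 * N + 1) - (3 * N + 1) * (3 * N)) (3 * N + 1)) =
    (N + 1) * (η ^ 2) ^ (3 * N ^ 2 + 4 * N + 1) := by
  have hN : (n : ℤ) = 3 * N + 2 := mod_cast hn
  have h := two_mul_sum_altTerm_cube_of_eq_two hη hn
  rw [Finset.sum_range_succ, sum_range_two_mul_eq_sum_center (altTerm (η ^ 3) (N + 1))] at h
  push_cast at h
  have hlast := zpow_mul_altTerm_cube hη N (2 * N + 1) (N + 1)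
  rw [lerchTerm_congr hη (a' := 2 * (6 * N ^ 2 + 3 * N) + n * (3 * N + 1) - (3 * N + 1) * (3 * N))
    (b' := 3 * N + 1) (-N) 1 (by rw [hN]; push_cast; ring) (by rw [hN]; ring)] at hlast
  have hexp : (η ^ 2) ^ (3 * N ^ 2 + 4 * N + 1) = -η ^ N := by
    rw [← pow_mul, show 2 * (3 * N ^ 2 + 4 * N + 1) = N + n * (2 * N + 1) by rw [hn]; ring,
      pow_add, pow_mul, pow_half_eq_neg_one hη, Odd.neg_one_pow ⟨N, rfl⟩, mul_neg_one]
  simp only [pairTerm_zero_of_eq_two hη hn]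
  rw [← Finset.mul_sum, ← hlast, hexp, ← mul_add, zpow_natCast]
  linear_combination η ^ N * h

end Evaluation

section DualCentralSum

open scoped DualNumber

lemma centralPair_succ_self {R : Type*} [CommRing R] (x : R) (j : ℕ) :
    centralPair x (j + 1) j = 1 := by
  rw [centralPair, show j + 1 + j + 1 = 2 * (j + 1) by ring, gaussBinom_self,
    gaussBinom_eq_zero_of_lt _ (by lia), mul_zero, sub_zero]

lemma dualPoint_pow_add_mul {R : Type*} [CommRing R] {z : R} {n : ℕ} (hz : z ^ n = 1) (a b : ℕ) :
    dualPoint z ^ (a + n * b) = dualPoint z ^ a + (n * b * z ^ a) • (ε : R[ε]) := by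
  rw [dualPoint_pow, dualPoint_pow, pow_add, pow_mul, hz, one_pow, mul_one]
  ext
  · simp
  · simp
    ring

variable {K : Type*} [Field K] {η : K} {n N : ℕ} [NeZero n]

lemma sum_dualPoint_pow_mul_centralPair (hη : IsPrimitiveRoot η (2 * n)) {s M : ℕ}
    (h : 3 * M + s ≤ n) :
    ∑ m ∈ Finset.range M, dualPoint (η ^ 2) ^ (6 * m ^ 2 + 4 * s * m + (3 * m + s)) *
      centralPair (dualPoint (η ^ 2)) n (3 * m + s) =
    (2 * n * ∑ m ∈ Finset.range M, pairTerm η n s m) • (ε : K[ε]) := by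
  rw [Finset.mul_sum, Finset.sum_smul]
  refine Finset.sum_congr rfl fun m hm => dualPoint_pow_mul_centralPair hη ?_
  rw [Finset.mem_range] at hm
  lia

lemma centralSum_zero_dualPoint_of_eq_one (hη : IsPrimitiveRoot η (2 * n)) (hn : n = 3 * N + 1) :
    centralSum (dualPoint (η ^ 2)) 0 n = dualPoint (η ^ 2) ^ (3 * N ^ 2 + 2 * N) := by
  have hz : (η ^ 2) ^ n = 1 := (hη.pow (NeZero.pos _) rfl).pow_eq_one
  have hexp : (η ^ 2) ^ (3 * N ^ 2 + 2 * N) = (η ^ 2) ^ N := by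
    rw [show 3 * N ^ 2 + 2 * N = N + n * N by rw [hn]; ring, pow_add, pow_mul, hz, one_pow, mul_one]
  have hlast : centralPair (dualPoint (η ^ 2)) n (3 * N) = 1 := hn ▸ centralPair_succ_self _ _
  have hsum := two_mul_sum_pairTerm_zero_of_eq_one hη hn
  rw [centralSum_eq_sum_centralPair _ 0 (N + 1) n (by lia), Finset.sum_range_succ,
    sum_dualPoint_pow_mul_centralPair hη (by lia), add_zero, hlast, mul_one,
    show 6 * N ^ 2 + 4 * 0 * N + 3 * N = 3 * N ^ 2 + 2 * N + n * N by rw [hn]; ring,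
    dualPoint_pow_add_mul hz, add_left_comm, ← add_smul, hexp]
  convert add_zero _
  convert zero_smul K (ε : K[ε])
  linear_combination n * hsum

lemma mul_centralSum_one_dualPoint_of_eq_one (hη : IsPrimitiveRoot η (2 * n))
    (hn : n = 3 * N + 1) :
    dualPoint (η ^ 2) * centralSum (dualPoint (η ^ 2)) 1 n = N * (dualPoint (η ^ 2) ^ n - 1) := by
  have hz : (η ^ 2) ^ n = 1 := (hη.pow (NeZero.pos _) rfl).pow_eq_one
  rw [centralSum_eq_sum_centralPair _ 1 N n (by lia), sum_dualPoint_pow_mul_centralPair hη (by lia),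
    mul_smul_eps, fst_dualPoint, mul_left_comm, mul_assoc 2, mul_left_comm 2,
    two_mul_sum_pairTerm_one_of_eq_one hη hn, dualPoint_pow, hz, one_smul, add_sub_cancel_left,
    mul_smul_eps, TrivSqZeroExt.fst_natCast, mul_comm]

lemma centralSum_zero_dualPoint_of_eq_two (hη : IsPrimitiveRoot η (2 * n)) (hn : n = 3 * N + 2) :
    centralSum (dualPoint (η ^ 2)) 0 n = -dualPoint (η ^ 2) ^ (3 * N ^ 2 + 4 * N + 1) := by
  have hz : (η ^ 2) ^ n = 1 := (hη.pow (NeZero.pos _) rfl).pow_eq_one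
  have hcentral := dualPoint_pow_mul_gaussBinom hη (j := 3 * N + 1) (by lia) (by lia)
    (6 * N ^ 2 + 3 * N)
  push_cast at hcentral
  rw [add_sub_cancel_right] at hcentral
  have hself : gaussBinom (dualPoint (η ^ 2)) (2 * n) (n + 3 * N + 2) = 1 := by
    rw [show n + 3 * N + 2 = 2 * n by lia, gaussBinom_self]
  have hsum := two_mul_sum_pairTerm_zero_of_eq_two hη hn
  rw [centralSum_eq_sum_centralPair _ 0 (N + 1) n (by lia), Finset.sum_range_succ,
    sum_dualPoint_pow_mul_centralPair hη (by lia), centralPair, add_zero, hself, mul_one, mul_sub,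
    ← pow_add, mul_zero, zero_mul, add_zero, add_assoc n, hcentral,
    show 6 * N ^ 2 + 3 * N + (2 * (3 * N) + 3) = 3 * N ^ 2 + 4 * N + 1 + n * (N + 1) by
      rw [hn]; ring,
    dualPoint_pow_add_mul hz, ← add_sub_assoc, ← add_smul, ← mul_add, mul_comm 2 (n : K), mul_assoc,
    hsum, ← mul_assoc, Nat.cast_add_one, sub_add_cancel_right]

lemma centralSum_one_dualPoint_of_eq_two (hη : IsPrimitiveRoot η (2 * n)) (hn : n = 3 * N + 2) :
    centralSum (dualPoint (η ^ 2)) 1 n = dualPoint (η ^ 2) ^ (6 * N ^ 2 + 7 * N + 1) := by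
  have hlast : centralPair (dualPoint (η ^ 2)) n (3 * N + 1) = 1 := hn ▸ centralPair_succ_self _ _
  rw [centralSum_eq_sum_centralPair _ 1 (N + 1) n (by lia), Finset.sum_range_succ,
    sum_dualPoint_pow_mul_centralPair hη (by lia), sum_pairTerm_one_of_eq_two hη hn, hlast,
    mul_zero, zero_smul, zero_add, mul_one]
  congr 1
  ring

end DualCentralSum

section Cyclotomic

variable {K : Type*} [Field K] [CharZero K] {η : K} {n N : ℕ} [NeZero n]

lemma qCongr_sum_qCatalan_of_dualPoint (hη : IsPrimitiveRoot η (2 * n)) {f : ℤ[X]}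
    (hf : centralSum (dualPoint (η ^ 2)) 0 n -
      dualPoint (η ^ 2) * centralSum (dualPoint (η ^ 2)) 1 n = aeval (dualPoint (η ^ 2)) f) :
    QCongr (∑ k ∈ Finset.range n, q ^ k * qCatalan k) (algebraMap ℤ[X] (RatFunc ℤ) f)
      (cyclotomic n ℤ ^ 2) := by
  have hz : IsPrimitiveRoot (η ^ 2) n := hη.pow (NeZero.pos _) rfl
  rw [cyclotomic_eq_minpoly hz (NeZero.pos n)]
  refine qCongr_sum_qCatalan (minpoly_sq_dvd (hz.isIntegral (NeZero.pos n))
    (hz.ne_zero (NeZero.ne n)) ?_)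
  simp only [map_sub, map_sum, map_mul, map_pow, map_gaussCatalan, aeval_X]
  rw [sum_pow_mul_gaussCatalan, hf, sub_self]

theorem qCongr_sum_qCatalan_of_eq_one (hη : IsPrimitiveRoot η (2 * n)) (hn : n = 3 * N + 1) :
    QCongr (∑ k ∈ Finset.range n, q ^ k * qCatalan k)
      (q ^ (3 * N ^ 2 + 2 * N) - N * (q ^ n - 1)) (cyclotomic n ℤ ^ 2) := by
  have h := qCongr_sum_qCatalan_of_dualPoint hη
    (f := X ^ (3 * N ^ 2 + 2 * N) - (N : ℤ[X]) * (X ^ n - 1)) (by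
      rw [centralSum_zero_dualPoint_of_eq_one hη hn, mul_centralSum_one_dualPoint_of_eq_one hη hn]
      simp)
  simpa [q] using h

theorem qCongr_sum_qCatalan_of_eq_two (hη : IsPrimitiveRoot η (2 * n)) (hn : n = 3 * N + 2) :
    QCongr (∑ k ∈ Finset.range n, q ^ k * qCatalan k)
      (-q ^ (3 * N ^ 2 + 4 * N + 1) - q ^ (6 * N ^ 2 + 7 * N + 2)) (cyclotomic n ℤ ^ 2) := by
  have h := qCongr_sum_qCatalan_of_dualPoint hη
    (f := -X ^ (3 * N ^ 2 + 4 * N + 1) - X ^ (6 * N ^ 2 + 7 * N + 2)) (by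
      rw [centralSum_zero_dualPoint_of_eq_two hη hn, centralSum_one_dualPoint_of_eq_two hη hn,
        ← pow_succ']
      simp)
  simpa [q] using h

end Cyclotomic

end QCatalan

theorem theorem1 (n : ℕ) (hn : 0 < n) :
    (n % 3 = 2 →
      QCatalan.QCongr
        (∑ k ∈ Finset.range n, QCatalan.q ^ k * QCatalan.qCatalan k)
        (-QCatalan.q ^ ((n ^ 2 - 1) / 3) - QCatalan.q ^ (n * (2 * n - 1) / 3))
        (Polynomial.cyclotomic n ℤ ^ 2)) ∧
    (n % 3 = 1 →
      QCatalan.QCongr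
        (∑ k ∈ Finset.range n, QCatalan.q ^ k * QCatalan.qCatalan k)
        (QCatalan.q ^ ((n ^ 2 - 1) / 3)
          - ((n : RatFunc ℤ) - 1) / 3 * (QCatalan.q ^ n - 1))
        (Polynomial.cyclotomic n ℤ ^ 2)) := by
  have : NeZero n := ⟨hn.ne'⟩
  have : CharZero (RatFunc ℤ) := IsFractionRing.charZero_of_isFractionRing ℤ[X]
  have hη := Complex.isPrimitiveRoot_exp (2 * n) (NeZero.ne _)
  refine ⟨fun h => ?_, fun h => ?_⟩
  · obtain ⟨N, hN⟩ : ∃ N, n = 3 * N + 2 := ⟨n / 3, by lia⟩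
    have hexp₁ : (n ^ 2 - 1) / 3 = 3 * N ^ 2 + 4 * N + 1 :=
      Nat.div_eq_of_eq_mul_right three_pos (Nat.sub_eq_of_eq_add (by rw [hN]; ring))
    have hexp₂ : n * (2 * n - 1) / 3 = 6 * N ^ 2 + 7 * N + 2 :=
      Nat.div_eq_of_eq_mul_right three_pos (by
        rw [show 2 * n - 1 = 3 * (2 * N + 1) by lia, hN]; ring)
    rw [hexp₁, hexp₂]
    exact QCatalan.qCongr_sum_qCatalan_of_eq_two hη hN
  · obtain ⟨N, hN⟩ : ∃ N, n = 3 * N + 1 := ⟨n / 3, by lia⟩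
    have hexp : (n ^ 2 - 1) / 3 = 3 * N ^ 2 + 2 * N :=
      Nat.div_eq_of_eq_mul_right three_pos (Nat.sub_eq_of_eq_add (by rw [hN]; ring))
    have hcoeff : ((n : RatFunc ℤ) - 1) / 3 = N := by
      rw [div_eq_iff three_ne_zero, hN]
      push_cast
      ring
    rw [hexp, hcoeff]
    exact QCatalan.qCongr_sum_qCatalan_of_eq_one hη hN
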